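/- Let $H$ be a Hilbert $C^*$-module over an arbitrary $C^*$-algebra $\mathfrak{A}$, let $\mathcal{L}(H)$ be the $C^*$-algebra of adjointable operators on $H$ with identity $I$, and for $T\in\mathcal{L}(H)$ put $|T|=(T^*T)^{1/2}$; let $\mathcal{R}(T)$ denote the range of $T$. A closed submodule $M\subseteq H$ is orthogonally complemented if $H=M+M^\perp$, where $M^\perp=\{x\in H:\langle x,y\rangle=0 \text{ for all } y\in M\}$; in that case $P_M$ denotes the projection onto $M$. An operator $T\in\mathcal{L}(H)$ has the polar decomposition if there is a partial isometry $U\in\mathcal{L}(H)$ with $T=U|T|$ and $U^*U=P_{\overline{\mathcal{R}(T^*)}}$ (in particular, $\overline{\mathcal{R}(T^*)}$ is orthogonally complemented). For a projection $P$ and an idempotent $Q$ in $\mathcal{L}(H)$, $(P,Q)$ is a quasi-projection pair if $PQ^*P=PQP$, $PQ^*(I-P)=-PQ(I-P)$ and $(I-P)Q^*(I-P)=(I-P)Q(I-P)$. A quasi-projection pair $(P,Q)$ is semi-harmonious if $P(I-Q)$ and $(I-P)Q$ both have the polar decomposition; it is harmonious if $\overline{\mathcal{R}(PQ(I-P))}$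 and $\overline{\mathcal{R}((I-P)QP)}$ are both orthogonally complemented in $H$. For an idempotent $Q\in\mathcal{L}(H)$, its matched projection is $$m(Q)=\tfrac12\big(|Q^*|+Q^*\big)\,|Q^*|^\dagger\,\big(|Q^*|+I\big)^{-1}\big(|Q^*|+Q\big),$$ where $|Q^*|^\dagger$ is the Moore–Penrose inverse of $|Q^*|$. Theorem. For every idempotent $Q\in\mathcal{L}(H)$, the matched pair $(m(Q),Q)$ is harmonious if and only if it is semi-harmonious. Moreover, $(m(Q),I-Q)$ is always a semi-harmonious quasi-projection pair. -/

import Mathlib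

/-!
Quasi-projection pairs of adjointable operators on a Hilbert C⋆-module.

Hilbert C⋆-modules are Mathlib's `CStarModule A H` together with completeness of `H`; the
`A`-valued inner product is linear in the second variable. Mathlib writes the scalars on the left,
`⟪x, a • y⟫ = a * ⟪x, y⟫`; right modules over a C⋆-algebra `B` are the case `A = Bᵐᵒᵖ`.
-/

noncomputable section

namespace HilbertCStar

section Operators

set_option linter.unusedSectionVars false

variable (A H : Type*) [NonUnitalCStarAlgebra A] [PartialOrder A] [StarOrderedRing A]
  [NormedAddCommGroup H] [NormedSpace ℂ H] [SMul A H] [CStarModule A H]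

/-- `S` is an adjoint of `T` for the `A`-valued inner product: `⟪T x, y⟫ = ⟪x, S y⟫`. -/
def IsAdjointPair (T S : H →L[ℂ] H) : Prop :=
  ∀ x y : H, inner A (T x) y = inner A x (S y)

variable {A H}

theorem inner_left_ext {x y : H} (h : ∀ z : H, inner A x z = inner A y z) : x = y := by
  have h1 : inner A (x - y) (x - y) = 0 := by
    rw [CStarModule.inner_sub_left, h, sub_self]
  exact sub_eq_zero.mp (CStarModule.inner_self.mp h1)

theorem inner_right_ext {x y : H} (h : ∀ z : H, inner A z x = inner A z y) : x = y := by
  refine inner_left_ext (A := A) fun z => ?_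
  rw [← CStarModule.star_inner z x, h, CStarModule.star_inner]

namespace IsAdjointPair

theorem symm {T S : H →L[ℂ] H} (h : IsAdjointPair A H T S) : IsAdjointPair A H S T := by
  intro x y
  rw [← CStarModule.star_inner y (S x), ← h y x, CStarModule.star_inner]

theorem unique {T S S' : H →L[ℂ] H} (h : IsAdjointPair A H T S) (h' : IsAdjointPair A H T S') :
    S = S' := by
  ext y
  exact inner_right_ext (A := A) fun z => by rw [← h, ← h']

theorem add {T S T' S' : H →L[ℂ] H} (h : IsAdjointPair A H T S) (h' : IsAdjointPair A H T' S') :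
    IsAdjointPair A H (T + T') (S + S') := by
  intro x y
  simp [h x y, h' x y]

theorem sub {T S T' S' : H →L[ℂ] H} (h : IsAdjointPair A H T S) (h' : IsAdjointPair A H T' S') :
    IsAdjointPair A H (T - T') (S - S') := by
  intro x y
  simp [h x y, h' x y]

theorem mul {T S T' S' : H →L[ℂ] H} (h : IsAdjointPair A H T S) (h' : IsAdjointPair A H T' S') :
    IsAdjointPair A H (T * T') (S' * S) := by
  intro x y
  simp [h _ y, h' x _]

theorem smul {T S : H →L[ℂ] H} (h : IsAdjointPair A H T S) (c : ℂ) :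
    IsAdjointPair A H (c • T) (star c • S) := by
  intro x y
  simp [h x y]

theorem norm_sq_le {T S : H →L[ℂ] H} (h : IsAdjointPair A H T S) : ‖T‖ * ‖T‖ ≤ ‖S * T‖ := by
  have h1 : ‖T‖ ≤ √‖S * T‖ := by
    refine T.opNorm_le_bound (Real.sqrt_nonneg _) fun x => ?_
    refine (sq_le_sq₀ (norm_nonneg _) (by positivity)).mp ?_
    rw [mul_pow, Real.sq_sqrt (norm_nonneg _), CStarModule.norm_sq_eq A, h x (T x)]
    calc ‖inner A x (S (T x))‖ ≤ ‖x‖ * ‖S (T x)‖ := CStarModule.norm_inner_le H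
      _ ≤ ‖x‖ * (‖S * T‖ * ‖x‖) := by
        gcongr
        exact (S * T).le_opNorm x
      _ = ‖S * T‖ * ‖x‖ ^ 2 := by ring
  calc ‖T‖ * ‖T‖ ≤ √‖S * T‖ * √‖S * T‖ := by gcongr
    _ = ‖S * T‖ := Real.mul_self_sqrt (norm_nonneg _)

theorem norm_le {T S : H →L[ℂ] H} (h : IsAdjointPair A H T S) : ‖T‖ ≤ ‖S‖ := by
  rcases eq_or_ne T 0 with rfl | hT
  · simp
  · exact le_of_mul_le_mul_right (h.norm_sq_le.trans (norm_mul_le S T)) (norm_pos_iff.mpr hT)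

end IsAdjointPair

variable (A H)

/-- The adjointable operators on `H`, as a subalgebra of the bounded operators. (Boundedness and
`A`-linearity of an adjointable map are automatic.) -/
def adjointableSubalgebra : Subalgebra ℂ (H →L[ℂ] H) where
  carrier := {T | ∃ S : H →L[ℂ] H, IsAdjointPair A H T S}
  mul_mem' := fun ⟨_, h⟩ ⟨_, h'⟩ => ⟨_, h.mul h'⟩
  add_mem' := fun ⟨_, h⟩ ⟨_, h'⟩ => ⟨_, h.add h'⟩
  algebraMap_mem' c := ⟨star c • 1, by
    rw [Algebra.algebraMap_eq_smul_one]
    exact IsAdjointPair.smul (fun _ _ => rfl) c⟩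

/-- `𝓛(H)`: the adjointable operators on `H`, with the operator norm. -/
abbrev Adjointable : Type _ := adjointableSubalgebra A H

variable {A H}

/-- The adjoint operation on `𝓛(H)`. -/
instance : Star (Adjointable A H) where
  star T := ⟨T.2.choose, T.1, T.2.choose_spec.symm⟩

theorem Adjointable.isAdjointPair (T : Adjointable A H) :
    IsAdjointPair A H (T : H →L[ℂ] H) (star T : Adjointable A H) :=
  T.2.choose_spec

theorem Adjointable.star_eq {T S : Adjointable A H}
    (h : IsAdjointPair A H (T : H →L[ℂ] H) S) : star T = S :=
  Subtype.ext (T.isAdjointPair.unique h)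

instance : StarRing (Adjointable A H) where
  star_involutive T := Adjointable.star_eq T.isAdjointPair.symm
  star_mul T S := Adjointable.star_eq (T.isAdjointPair.mul S.isAdjointPair)
  star_add T S := Adjointable.star_eq (T.isAdjointPair.add S.isAdjointPair)

instance : StarModule ℂ (Adjointable A H) where
  star_smul c T := Adjointable.star_eq (T.isAdjointPair.smul c)

instance : CStarRing (Adjointable A H) where
  norm_mul_self_le T := T.isAdjointPair.norm_sq_le

theorem isClosed_adjointable [CompleteSpace H] :
    IsClosed (adjointableSubalgebra A H : Set (H →L[ℂ] H)) := by
  refine IsSeqClosed.isClosed fun u T hu hT => ?_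
  choose S hS using hu
  have hC : CauchySeq S := by
    have hu' := hT.cauchySeq
    rw [Metric.cauchySeq_iff] at hu' ⊢
    intro ε hε
    obtain ⟨N, hN⟩ := hu' ε hε
    refine ⟨N, fun m hm n hn => lt_of_le_of_lt ?_ (hN m hm n hn)⟩
    rw [dist_eq_norm, dist_eq_norm]
    exact ((hS m).sub (hS n)).symm.norm_le
  obtain ⟨S', hS'⟩ := cauchySeq_tendsto_of_complete hC
  refine ⟨S', fun x y => ?_⟩
  have h1 : Filter.Tendsto (fun n => inner A (u n x) y) Filter.atTop (nhds (inner A (T x) y)) :=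
    (CStarModule.continuous_inner (A := A) (E := H)).continuousAt.tendsto.comp
      ((((ContinuousLinearMap.apply ℂ H x).continuous.tendsto T).comp hT).prodMk_nhds
        tendsto_const_nhds)
  have h2 : Filter.Tendsto (fun n => inner A x (S n y)) Filter.atTop (nhds (inner A x (S' y))) :=
    (CStarModule.continuous_inner (A := A) (E := H)).continuousAt.tendsto.comp
      (tendsto_const_nhds.prodMk_nhds
        (((ContinuousLinearMap.apply ℂ H y).continuous.tendsto S').comp hS'))
  have h3 : (fun n => inner A (u n x) y) = fun n => inner A x (S n y) :=
    funext fun n => hS n x y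
  rw [h3] at h1
  exact tendsto_nhds_unique h1 h2

instance [CompleteSpace H] : CompleteSpace (Adjointable A H) :=
  isClosed_adjointable.completeSpace_coe

/-- `𝓛(H)` is a unital C⋆-algebra. -/
instance [CompleteSpace H] : CStarAlgebra (Adjointable A H) where

/-- The order of the C⋆-algebra `𝓛(H)`. -/
instance [CompleteSpace H] : PartialOrder (Adjointable A H) :=
  CStarAlgebra.spectralOrder _

instance [CompleteSpace H] : StarOrderedRing (Adjointable A H) :=
  CStarAlgebra.spectralOrderedRing _

/-- The range of an adjointable operator. -/
def range (T : Adjointable A H) : Submodule ℂ H :=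
  LinearMap.range ((T : H →L[ℂ] H) : H →ₗ[ℂ] H)

/-- The closure of the range of an adjointable operator. -/
def closedRange (T : Adjointable A H) : Submodule ℂ H :=
  (range T).topologicalClosure

variable (A) in
/-- `M^⊥ = {x | ⟪x, y⟫ = 0 for every y ∈ M}`. -/
def orthogonal (M : Submodule ℂ H) : Submodule ℂ H where
  carrier := {x | ∀ y ∈ M, inner A x y = 0}
  add_mem' := fun hx hx' y hy => by simp [hx y hy, hx' y hy]
  zero_mem' := fun y _ => by simp
  smul_mem' := fun c x hx y hy => by simp [hx y hy]

variable (A) in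
/-- A closed submodule `M` is orthogonally complemented if `H = M + M^⊥`. -/
def IsOrthogonallyComplemented (M : Submodule ℂ H) : Prop :=
  IsClosed (M : Set H) ∧ M ⊔ orthogonal A M = ⊤

end Operators

section Pairs

variable {A H : Type*} [NonUnitalCStarAlgebra A] [PartialOrder A] [StarOrderedRing A]
  [NormedAddCommGroup H] [NormedSpace ℂ H] [CompleteSpace H] [SMul A H] [CStarModule A H]

/-- `T` has the polar decomposition: there is a partial isometry `U` with `T = U |T|` and `U⋆U` the
projection onto the closure of the range of `T⋆`, where `|T| = (T⋆T)^(1/2)` is `CFC.abs T`. -/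
def HasPolarDecomposition (T : Adjointable A H) : Prop :=
  ∃ U : Adjointable A H, U * star U * U = U ∧ T = U * CFC.abs T ∧
    IsStarProjection (star U * U) ∧ range (star U * U) = closedRange (star T)

/-- `X` satisfies the four Penrose equations for `T`. -/
structure IsMoorePenroseInverse (T X : Adjointable A H) : Prop where
  mul_mul_self : T * X * T = T
  self_mul_mul : X * T * X = X
  isSelfAdjoint_mul : IsSelfAdjoint (T * X)
  isSelfAdjoint_mul' : IsSelfAdjoint (X * T)

/-- There is at most one Moore-Penrose inverse. -/
theorem IsMoorePenroseInverse.unique {T X Y : Adjointable A H} (hX : IsMoorePenroseInverse T X)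
    (hY : IsMoorePenroseInverse T Y) : X = Y := by
  have h1 : T * X = T * Y := by
    calc T * X = star (T * X) := hX.isSelfAdjoint_mul.symm
      _ = star ((T * Y) * (T * X)) := by rw [← mul_assoc, hY.mul_mul_self]
      _ = (T * X) * (T * Y) := by
        rw [star_mul, hX.isSelfAdjoint_mul.star_eq, hY.isSelfAdjoint_mul.star_eq]
      _ = T * Y := by rw [← mul_assoc, hX.mul_mul_self]
  have h2 : X * T = Y * T := by
    calc X * T = star (X * T) := hX.isSelfAdjoint_mul'.symm
      _ = star ((X * T) * (Y * T)) := by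
        rw [mul_assoc X T, ← mul_assoc T Y T, hY.mul_mul_self]
      _ = (Y * T) * (X * T) := by
        rw [star_mul, hX.isSelfAdjoint_mul'.star_eq, hY.isSelfAdjoint_mul'.star_eq]
      _ = Y * T := by rw [mul_assoc Y T, ← mul_assoc T X T, hX.mul_mul_self]
  calc X = X * T * X := hX.self_mul_mul.symm
    _ = Y * T * Y := by rw [h2, mul_assoc, h1, ← mul_assoc]
    _ = Y := hY.self_mul_mul

open Classical in
/-- The Moore-Penrose inverse `T†` (with value `0` if there is none). -/
def moorePenroseInverse (T : Adjointable A H) : Adjointable A H :=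
  if h : ∃ X, IsMoorePenroseInverse T X then h.choose else 0

/-- The matched projection of an idempotent `Q`,
`m(Q) = (1/2) (|Q⋆| + Q⋆) |Q⋆|† (|Q⋆| + I)⁻¹ (|Q⋆| + Q)`. -/
def matchedProjection (Q : Adjointable A H) : Adjointable A H :=
  (1 / 2 : ℂ) • ((CFC.abs (star Q) + star Q) * moorePenroseInverse (CFC.abs (star Q)) *
    Ring.inverse (CFC.abs (star Q) + 1) * (CFC.abs (star Q) + Q))

/-- `(P, Q)` is a quasi-projection pair. -/
structure IsQuasiProjectionPair (P Q : Adjointable A H) : Prop where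
  isStarProjection : IsStarProjection P
  isIdempotentElem : IsIdempotentElem Q
  corner_left : P * star Q * P = P * Q * P
  off_diagonal : P * star Q * (1 - P) = -(P * Q * (1 - P))
  corner_right : (1 - P) * star Q * (1 - P) = (1 - P) * Q * (1 - P)

/-- A quasi-projection pair `(P, Q)` is semi-harmonious if `P (I - Q)` and `(I - P) Q` both have
the polar decomposition. -/
structure IsSemiHarmonious (P Q : Adjointable A H) : Prop where
  isQuasiProjectionPair : IsQuasiProjectionPair P Q
  polar_left : HasPolarDecomposition (P * (1 - Q))
  polar_right : HasPolarDecomposition ((1 - P) * Q)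

/-- A quasi-projection pair `(P, Q)` is harmonious if the closures of the ranges of `P Q (I - P)`
and `(I - P) Q P` are both orthogonally complemented. -/
structure IsHarmonious (P Q : Adjointable A H) : Prop where
  isQuasiProjectionPair : IsQuasiProjectionPair P Q
  complemented_left : IsOrthogonallyComplemented A (closedRange (P * Q * (1 - P)))
  complemented_right : IsOrthogonallyComplemented A (closedRange ((1 - P) * Q * P))

end Pairs

end HilbertCStar

end

/-! Put `a = |Q⋆|` and `P = m(Q)`. The formula for `P` is that of the projection onto the range of
`a + Q⋆`, and it gives `Q P = (a + Q) / 2`, so `Q = a (2P - 1)` and `Q⋆ = (2P - 1) a`. The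
identities of a quasi-projection pair follow, together with two positivity facts: `K = P Q P - P ≥
0` and `(1 - P)(1 - Q)(1 - P) - (1 - P) ≥ 0`. The second is the first for the pair `(1 - P, 1 - Q)`,
so each argument below serves both corners.

Let `Y = P Q (1 - P)`. Idempotency of `Q` gives `Y Y⋆ = K (1 + K)`, and `P (1 - Q) = -(K + Y)` with
`(K + Y)(K + Y)⋆ = K (1 + 2K)`. Since `T T⋆` and `T` have the same closed range and the factors `1 +
K`, `1 + 2K` are invertible, `K`, `Y` and `P (1 - Q)` share one closed range. An operator with a
polar decomposition has complemented closed range, so semi-harmonious implies harmonious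
(`closedRanges`).

Conversely, if the closed ranges of `Y` and `Y⋆` are complemented, with `F` the projection onto the
former, then `Y = K^(1/2) (1 + K)^(1/2) V⋆` for a partial isometry `V`. Hence `K + Y = K^(1/2) N`
with `N N⋆ = (1 + 2K) F`, and normalising `N` on the left yields the polar decomposition
(`hasPolarDecomposition_mul_one_sub`).

For `(P, 1 - Q)` nothing need be assumed: `P Q (P Q)⋆ = (1 + 3K + 2K²) P` is invertible in the
corner of `P` (`hasPolarDecomposition_mul`). -/

noncomputable section
namespace HilbertCStar

/-! ### Square roots, inverses and idempotents in a unital C⋆-algebra. -/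

section CStarAlgebra

variable {𝓐 : Type*} [CStarAlgebra 𝓐] [PartialOrder 𝓐] [StarOrderedRing 𝓐]

/-- A positive element has a positive square root, which commutes with whatever the element
commutes with. -/
theorem exists_nonneg_sqrt {k : 𝓐} (hk : 0 ≤ k) :
    ∃ r : 𝓐, 0 ≤ r ∧ r * r = k ∧ ∀ x, Commute k x → Commute r x := by
  refine ⟨CFC.sqrt k, CFC.sqrt_nonneg k, CFC.sqrt_mul_sqrt_self k, fun x hx => ?_⟩
  exact hx.cfcₙ_nnreal _

/-- `1 + k` has a positive inverse for `k ≥ 0`. -/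
theorem exists_nonneg_inverse {k : 𝓐} (hk : 0 ≤ k) :
    ∃ h : 𝓐, 0 ≤ h ∧ h * (1 + k) = 1 ∧ (1 + k) * h = 1 ∧ ∀ x, Commute k x → Commute h x := by
  have hu : IsUnit (1 + k) := CStarAlgebra.isUnit_of_le 1 (le_add_of_nonneg_right hk)
  obtain ⟨u, hu⟩ := hu
  have hcomm : ∀ x, Commute k x → Commute (↑u⁻¹ : 𝓐) x := fun x hx => by
    refine Commute.units_inv_left ?_
    rw [hu]
    exact (Commute.one_left x).add_left hx
  have hp : 0 ≤ 1 + k := add_nonneg zero_le_one hk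
  refine ⟨↑u⁻¹, ?_, by rw [← hu, u.inv_mul], by rw [← hu, u.mul_inv], hcomm⟩
  have hs : star (↑u⁻¹ : 𝓐) = ↑u⁻¹ := by
    have h1 : star (↑u⁻¹ : 𝓐) * u = 1 := by
      have h2 : star (u : 𝓐) = u := by rw [hu]; exact hp.isSelfAdjoint
      calc star (↑u⁻¹ : 𝓐) * u = star ((u : 𝓐) * ↑u⁻¹) := by rw [star_mul, h2]
        _ = 1 := by simp
    calc star (↑u⁻¹ : 𝓐) = star (↑u⁻¹ : 𝓐) * u * ↑u⁻¹ := by simp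
      _ = ↑u⁻¹ := by rw [h1, one_mul]
  have h3 : (↑u⁻¹ : 𝓐) = star (↑u⁻¹ : 𝓐) * (1 + k) * ↑u⁻¹ := by
    rw [hs, ← hu]; simp
  rw [h3]
  exact star_left_conjugate_nonneg hp _

/-- Every element `t` is the limit of elements `t t⋆ z`. -/
theorem exists_norm_sub_mul_star_mul_le (t : 𝓐) {ε : ℝ} (hε : 0 < ε) :
    ∃ z : 𝓐, ‖t - t * star t * z‖ ^ 2 ≤ ε := by
  have hk : 0 ≤ ε⁻¹ • (t * star t) := smul_nonneg (by positivity) (mul_star_self_nonneg t)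
  obtain ⟨h, h0, h1, h2, hc⟩ := exists_nonneg_inverse hk
  have hsum : h + h * (ε⁻¹ • (t * star t)) = 1 := by rw [← h1, mul_add, mul_one]
  have hm0 : 0 ≤ h * (ε⁻¹ • (t * star t)) := (hc _ (Commute.refl _)).mul_nonneg h0 hk
  have hn1 : ‖h‖ ≤ 1 := by
    rw [CStarAlgebra.norm_le_one_iff_of_nonneg h h0, ← hsum]
    exact le_add_of_nonneg_right hm0
  have hn2 : ‖h * (ε⁻¹ • (t * star t))‖ ≤ 1 := by
    rw [CStarAlgebra.norm_le_one_iff_of_nonneg _ hm0, ← hsum]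
    exact le_add_of_nonneg_left h0
  -- With `h = (1 + ε⁻¹ t t⋆)⁻¹` this choice leaves the remainder `h t`, and `‖h t‖² = ε ‖h (ε⁻¹ t
  -- t⋆) h‖`, where `h` and `h (ε⁻¹ t t⋆)` are positive with sum `1`.
  refine ⟨h * (ε⁻¹ • t), ?_⟩
  have hz : t - t * star t * (h * (ε⁻¹ • t)) = h * t := by
    have h3 : t * star t * (h * (ε⁻¹ • t)) = (ε⁻¹ • (t * star t)) * h * t := by
      simp [mul_assoc]
    rw [h3, ← (hc _ (Commute.refl _)).eq]
    nth_rewrite 1 [← one_mul t]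
    rw [← sub_mul, ← hsum, add_sub_cancel_right]
  rw [hz, sq, ← CStarRing.norm_self_mul_star, star_mul, h0.isSelfAdjoint.star_eq]
  have h4 : h * t * (star t * h) = ε • (h * (ε⁻¹ • (t * star t)) * h) := by
    simp [mul_assoc, smul_smul, hε.ne']
  rw [h4, norm_smul, Real.norm_of_nonneg hε.le]
  calc ε * ‖h * (ε⁻¹ • (t * star t)) * h‖ ≤ ε * (1 * 1) := by
        gcongr
        exact (norm_mul_le _ _).trans (by gcongr)
    _ = ε := by ring

/-- The range projection of an idempotent. -/
theorem exists_range_projection {q : 𝓐} (hq : IsIdempotentElem q) :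
    ∃ e : 𝓐, IsStarProjection e ∧ q * e = e ∧ e * q = q := by
  have hq' : q * q = q := hq
  have hqs : star q * star q = star q := by rw [← star_mul, hq']
  -- The element `1 + (q - q⋆)(q - q⋆)⋆` commutes with `q` and `q⋆`, and its product with `q` is `q
  -- q⋆ q`. Hence `q q⋆ z`, with `z` its inverse, is a projection fixing `q`.
  obtain ⟨z, z0, z1, z2, zc⟩ := exists_nonneg_inverse (mul_star_self_nonneg (q - star q))
  have hk : (q - star q) * star (q - star q) = q * star q - q - star q + star q * q := by
    rw [star_sub, star_star, sub_mul, mul_sub, mul_sub, hq', hqs]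
    abel
  rw [hk] at z1 z2 zc
  have e1 : q * (q * star q - q - star q + star q * q) = q * (star q * q) - q := by
    rw [mul_add, mul_sub, mul_sub, ← mul_assoc q q, hq']; abel
  have e2 : (q * star q - q - star q + star q * q) * q = q * (star q * q) - q := by
    rw [add_mul, sub_mul, sub_mul, mul_assoc (star q) q q, hq', mul_assoc]; abel
  have e3 : star q * (q * star q - q - star q + star q * q) = star q * (q * star q) - star q := by
    rw [mul_add, mul_sub, mul_sub, ← mul_assoc (star q) (star q), hqs]; abel
  have e4 : (q * star q - q - star q + star q * q) * star q = star q * (q * star q) - star q := by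
    rw [add_mul, sub_mul, sub_mul, mul_assoc q (star q) (star q), hqs, mul_assoc]; abel
  have c1 : z * q = q * z := zc q (e2.trans e1.symm)
  have c2 : z * star q = star q * z := zc (star q) (e4.trans e3.symm)
  have hE : q * (q * star q * z) = q * star q * z := by rw [← mul_assoc, ← mul_assoc, hq']
  have hEq : q * star q * z * q = q := by
    calc q * star q * z * q = (q * (star q * q)) * z := by
          rw [mul_assoc, c1]; simp only [mul_assoc]
      _ = (q * (1 + (q * star q - q - star q + star q * q))) * z := by
          rw [mul_add, e1]; simp
      _ = q := by rw [mul_assoc, z2, mul_one]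
  refine ⟨q * star q * z, ⟨?_, ?_⟩, hE, hEq⟩
  · calc q * star q * z * (q * star q * z) = (q * star q * z * q) * (star q * z) := by
          simp only [mul_assoc]
      _ = q * star q * z := by rw [hEq, mul_assoc]
  · rw [isSelfAdjoint_iff, star_mul, star_mul, star_star, z0.isSelfAdjoint.star_eq, ← mul_assoc, c1,
      mul_assoc, c2, mul_assoc]

/-- The absolute value of the adjoint of an idempotent is invertible in the corner of the range
projection. -/
theorem exists_corner_inverse {q e : 𝓐} (he : IsStarProjection e)
    (hqe : q * e = e) (heq : e * q = q) :
    e * CFC.abs (star q) = CFC.abs (star q) ∧ CFC.abs (star q) * e = CFC.abs (star q) ∧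
    ∃ c : 𝓐, 0 ≤ c ∧ CFC.abs (star q) * c = e ∧ c * CFC.abs (star q) = e ∧ c * e = c ∧
      e * c = c := by
  set a := CFC.abs (star q) with ha
  have a0 : 0 ≤ a := CFC.abs_nonneg _
  have as : star a = a := a0.isSelfAdjoint.star_eq
  have aa : a * a = q * star q := by simpa using CFC.abs_mul_abs (star q)
  have ee : e * e = e := he.isIdempotentElem
  have es : star e = e := he.isSelfAdjoint
  have hes : e * star q = e := by rw [← es, ← star_mul, hqe]
  have hse : star q * e = star q := by rw [← es, ← star_mul, heq]
  have hae : a * e = a := by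
    have h1 : star (a * (1 - e)) * (a * (1 - e)) = 0 := by
      have : a * a * (1 - e) = 0 := by rw [aa, mul_sub, mul_one, mul_assoc, hse, sub_self]
      rw [star_mul, as, mul_assoc, ← mul_assoc a, this, mul_zero]
    have h2 := CStarRing.star_mul_self_eq_zero_iff _ |>.mp h1
    rw [mul_sub, mul_one, sub_eq_zero] at h2
    exact h2.symm
  have hea : e * a = a := by rw [← as, ← es, ← star_mul, hae]
  refine ⟨hea, hae, ?_⟩
  -- Adding `1 - e` fills the complementary corner. The square is then at least `1`, so `a + (1 -
  -- e)` is invertible, and cutting its inverse down by `e` gives `c`.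
  have hsq : (a + (1 - e)) * (a + (1 - e)) = 1 + (q - e) * star (q - e) := by
    simp only [star_sub, es, sub_mul, mul_sub, hqe, hes, ee, ← aa, add_mul, mul_add, hea, hae,
      mul_one, one_mul]
    abel
  have hu : IsUnit (a + (1 - e)) := by
    rw [← isUnit_pow_iff two_ne_zero, sq, hsq]
    exact CStarAlgebra.isUnit_of_le 1 (le_add_of_nonneg_right (mul_star_self_nonneg _))
  obtain ⟨u, hu⟩ := hu
  have ue : (u : 𝓐) * e = a := by rw [hu, add_mul, sub_mul, hae, ee]; simp
  have eu : e * (u : 𝓐) = a := by rw [hu, mul_add, mul_sub, hea, ee]; simp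
  have hce : Commute (↑u⁻¹ : 𝓐) e := Commute.units_inv_left (ue.trans eu.symm)
  have hac : a * (↑u⁻¹ * e) = e := by
    rw [← mul_assoc, ← eu, mul_assoc e, u.mul_inv, mul_one, ee]
  have hca : (↑u⁻¹ * e) * a = e := by rw [mul_assoc, hea, ← ue, ← mul_assoc, u.inv_mul, one_mul]
  have hcE : (↑u⁻¹ * e) * e = (↑u⁻¹ * e) := by rw [mul_assoc, ee]
  have hEc : e * (↑u⁻¹ * e) = (↑u⁻¹ * e) := by rw [← mul_assoc, ← hce.eq, hcE]
  refine ⟨↑u⁻¹ * e, ?_, hac, hca, hcE, hEc⟩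
  generalize (↑u⁻¹ * e : 𝓐) = c at *
  have hcs : star c = c := by
    calc star c = star c * e := by rw [← es, ← star_mul, hEc]
      _ = star c * a * c := by rw [mul_assoc, hac]
      _ = star (a * c) * c := by rw [star_mul, as]
      _ = c := by rw [hac, es, hEc]
  have : c = star c * a * c := by rw [hcs, hca, hEc]
  rw [this]
  exact star_left_conjugate_nonneg a0 _

/-- The projection `(1/2) (a + q⋆) c (a + 1)⁻¹ (a + q)` built from an idempotent `q` with range
projection `e`, where `a = |q⋆|` and `c` is the inverse of `a` in the corner of `e`. -/
theorem matched_projection_properties {q e a c : 𝓐} (he : IsStarProjection e)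
    (hqe : q * e = e) (heq : e * q = q) (a0 : 0 ≤ a) (aa : a * a = q * star q)
    (hea : e * a = a) (hae : a * e = a) (c0 : 0 ≤ c) (hac : a * c = e) (hca : c * a = e)
    (hce : c * e = c) (hec : e * c = c) (hq : IsIdempotentElem q) {p : 𝓐}
    (hp : p = (1 / 2 : ℂ) • ((a + star q) * c * Ring.inverse (a + 1) * (a + q))) :
    IsStarProjection p ∧ q * p = (1 / 2 : ℂ) • (a + q) ∧ 0 ≤ p * q * p - p := by
  have as : star a = a := a0.isSelfAdjoint.star_eq
  have cs : star c = c := c0.isSelfAdjoint.star_eq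
  have ee : e * e = e := he.isIdempotentElem
  have es : star e = e := he.isSelfAdjoint
  have hes : e * star q = e := by rw [← es, ← star_mul, hqe]
  have qq : q * q = q := hq
  have hqa : q * a = a := by rw [← hea, ← mul_assoc, hqe]
  have haqs : a * star q = a := by rw [← hae, mul_assoc, hes]
  obtain ⟨h, h0, h1, h2, hcomm⟩ := exists_nonneg_inverse a0
  rw [add_comm] at h1 h2
  have hs : star h = h := h0.isSelfAdjoint.star_eq
  -- As `a + 1` is a unit, `Ring.inverse` does not take its default value `0`.
  have hinv : Ring.inverse (a + 1) = h := by
    have : IsUnit (a + 1) := ⟨⟨a + 1, h, h2, h1⟩, rfl⟩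
    calc Ring.inverse (a + 1) = Ring.inverse (a + 1) * ((a + 1) * h) := by rw [h2, mul_one]
      _ = h := by rw [← mul_assoc, Ring.inverse_mul_cancel _ this, one_mul]
  rw [hinv] at hp
  have hha : h * a = a * h := hcomm a (Commute.refl a)
  have hhc : h * c = c * h := hcomm c (hac.trans hca.symm)
  have hhe : h * e = e * h := hcomm e (hae.trans hea.symm)
  set v := a + star q with hv
  have hvs : star v = a + q := by rw [hv, star_add, as, star_star]
  -- Thus `(1/2) c h` inverts `v⋆ v` in the corner of `e`, and `p = v ((1/2) c h) v⋆` is the usual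
  -- formula for a range projection.
  have hvv : star v * v = (2 : ℂ) • (a * (a + 1)) := by
    rw [hvs, hv, add_mul, mul_add, mul_add, haqs, hqa, ← aa, mul_add, mul_one, two_smul]
    abel
  have hqv : q * v = a * (a + 1) := by
    rw [hv, mul_add, hqa, ← aa, mul_add, mul_one, add_comm]
  have hcancel : a * (a + 1) * (c * h) = e := by
    rw [← hhc, mul_assoc, ← mul_assoc (a + 1), h2, one_mul, hac]
  rw [← hvs] at hp
  have hqp : q * p = (1 / 2 : ℂ) • star v := by
    rw [hp, mul_smul_comm]
    congr 1
    calc q * (v * c * h * star v) = (q * v) * (c * h) * star v := by simp only [mul_assoc]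
      _ = star v := by rw [hqv, hcancel, hvs, mul_add, hea, heq]
  have hps : star p = p := by
    rw [hp, star_smul, star_mul, star_mul, star_mul, star_star, cs, hs]
    simp only [← mul_assoc]
    rw [mul_assoc v h c, hhc]
    simp [mul_assoc]
  have hpp : p * p = p := by
    have : v * c * h * star v * (v * c * h * star v) = (2 : ℂ) • (v * c * h * star v) := by
      calc v * c * h * star v * (v * c * h * star v)
          = v * c * h * ((star v * v) * (c * h)) * star v := by simp only [mul_assoc]
        _ = (2 : ℂ) • (v * (c * (h * e)) * star v) := by
          rw [hvv, smul_mul_assoc, hcancel]; simp [mul_assoc]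
        _ = (2 : ℂ) • (v * c * h * star v) := by
          rw [hhe, ← mul_assoc c, hce]; simp only [mul_assoc]
    rw [hp, smul_mul_smul_comm, this, smul_smul]
    norm_num
  refine ⟨⟨hpp, hps⟩, by rw [hqp, hvs], ?_⟩
  have hpq : p * q = (1 / 2 : ℂ) • (v * c * q) := by
    rw [hp, smul_mul_assoc]
    congr 1
    calc v * c * h * star v * q = v * c * (h * ((a + 1) * q)) := by
          rw [hvs, mul_assoc _ _ q, add_mul a q q, qq, add_mul a 1 q, one_mul, mul_assoc (v * c)]
      _ = v * c * q := by rw [← mul_assoc h, h1, one_mul]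
  -- In the corner, `a² - e = (q - e)(q - e)⋆ ≥ 0`; dividing by the commuting factor `a + 1` gives
  -- `a ≥ e`.
  have hae0 : 0 ≤ a - e := by
    have h3 : a - e = (q - e) * star (q - e) * h := by
      have : (q - e) * star (q - e) = (a - e) * (a + 1) := by
        simp only [star_sub, es, sub_mul, mul_sub, hqe, hes, ee, ← aa, mul_add, hea, mul_one]
        abel
      rw [this, mul_assoc, h2, mul_one]
    have h4 : Commute ((q - e) * star (q - e)) h := by
      have h5 : (q - e) * star (q - e) = a * a - e := by
        simp only [star_sub, es, sub_mul, mul_sub, hqe, hes, ee, ← aa]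
        abel
      rw [h5]
      have h6 : Commute h a := hha
      exact ((h6.mul_right h6).sub_right hhe).symm
    rw [h3]
    exact h4.mul_nonneg (mul_star_self_nonneg _) h0
  have hac' : Commute c (a - e) := Commute.sub_right (hca.trans hac.symm) (hce.trans hec.symm)
  have hah : Commute (c * (a - e)) h := by
    have h1 : Commute h (c * (a - e)) := Commute.mul_right hhc (Commute.sub_right hha hhe)
    exact h1.symm
  have hpos : 0 ≤ c * (a - e) * h := hah.mul_nonneg (hac'.mul_nonneg c0 hae0) h0
  have hfin : p * q * p - p = (1 / 4 : ℝ) • (v * (c * (a - e) * h) * star v) := by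
    have h4 : c * (a - e) * h = c - (2 : ℂ) • (c * h) := by
      have : c = c * (a + 1) * h := by rw [mul_assoc, h2, mul_one]
      nth_rewrite 2 [this]
      rw [mul_sub, mul_add, hce, sub_mul, add_mul, mul_one, two_smul]
      abel
    have h5 : p * q * p = (1 / 4 : ℂ) • (v * c * star v) := by
      rw [hpq, smul_mul_assoc, mul_assoc _ q p, hqp, mul_smul_comm, smul_smul]
      norm_num
    rw [h4, h5, hp, mul_sub, sub_mul, mul_smul_comm, smul_mul_assoc]
    simp only [mul_assoc]
    generalize v * (c * star v) = x
    generalize v * (c * (h * star v)) = y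
    rw [← Complex.coe_smul, smul_sub, smul_smul]
    norm_num
  rw [hfin]
  exact smul_nonneg (by norm_num) (star_right_conjugate_nonneg hpos v)

end CStarAlgebra
end HilbertCStar
end

noncomputable section
namespace HilbertCStar

/-! ### Ranges, projections and polar decompositions of adjointable operators. -/

section Modules

set_option linter.unusedSectionVars false

variable {A H : Type*} [NonUnitalCStarAlgebra A] [PartialOrder A] [StarOrderedRing A]
  [NormedAddCommGroup H] [NormedSpace ℂ H] [CompleteSpace H] [SMul A H] [CStarModule A H]

theorem inner_adjoint (T : Adjointable A H) (x y : H) :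
    inner A (T.1 x) y = inner A x ((star T).1 y) := T.isAdjointPair x y

theorem apply_mem_range (T : Adjointable A H) (x : H) : T.1 x ∈ range T := ⟨x, rfl⟩

theorem range_le_closedRange (T : Adjointable A H) : range T ≤ closedRange T :=
  Submodule.le_topologicalClosure _

theorem range_mul_le (T S : Adjointable A H) : range (T * S) ≤ range T := by
  rintro _ ⟨x, rfl⟩
  exact ⟨S.1 x, rfl⟩

theorem range_neg (T : Adjointable A H) : range (-T) = range T := by
  refine le_antisymm ?_ ?_
  · rintro _ ⟨x, rfl⟩
    exact ⟨-x, by simp⟩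
  · rintro _ ⟨x, rfl⟩
    exact ⟨-x, by simp⟩

theorem closedRange_neg (T : Adjointable A H) : closedRange (-T) = closedRange T := by
  rw [closedRange, range_neg, closedRange]

/-- Serves to discard right factors such as `1 + K` from a range. -/
theorem range_mul_of_rightInverse {T S Z : Adjointable A H} (h : S * Z = 1) :
    range (T * S) = range T := by
  refine le_antisymm (range_mul_le T S) ?_
  calc range T = range (T * S * Z) := by rw [mul_assoc, h, mul_one]
    _ ≤ range (T * S) := range_mul_le _ _

theorem closedRange_mul_of_rightInverse {T S Z : Adjointable A H} (h : S * Z = 1) :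
    closedRange (T * S) = closedRange T := by
  rw [closedRange, range_mul_of_rightInverse h, closedRange]

theorem closedRange_mono {T S : Adjointable A H} (h : range T ≤ range S) :
    closedRange T ≤ closedRange S :=
  Submodule.topologicalClosure_mono h

theorem apply_eq_of_mem_range {F : Adjointable A H} (hF : IsIdempotentElem F) {x : H}
    (hx : x ∈ range F) : F.1 x = x := by
  obtain ⟨y, rfl⟩ := hx
  exact congrArg (fun T : Adjointable A H => T.1 y) (show F * F = F from hF)

theorem isClosed_range {F : Adjointable A H} (hF : IsIdempotentElem F) :
    IsClosed (range F : Set H) := by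
  have : (range F : Set H) = {x | F.1 x = x} := by
    ext x
    exact ⟨fun hx => apply_eq_of_mem_range hF hx, fun hx => ⟨x, hx⟩⟩
  rw [this]
  exact isClosed_eq F.1.continuous continuous_id

theorem closedRange_le_range {F T : Adjointable A H} (hF : IsIdempotentElem F) (h : F * T = T) :
    closedRange T ≤ range F :=
  Submodule.topologicalClosure_minimal _ (by rw [← h]; exact range_mul_le _ _) (isClosed_range hF)

theorem closedRange_eq_range {F : Adjointable A H} (hF : IsIdempotentElem F) :
    closedRange F = range F :=
  le_antisymm (closedRange_le_range hF hF) (range_le_closedRange F)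

theorem mul_eq_of_closedRange {F T : Adjointable A H} (hF : IsIdempotentElem F)
    (h : range F = closedRange T) : F * T = T := by
  refine Subtype.ext (ContinuousLinearMap.ext fun x => ?_)
  exact apply_eq_of_mem_range hF (h ▸ range_le_closedRange T (apply_mem_range T x))

/-- A bounded operator maps the closure of a range into the closure of the image. -/
theorem apply_mem_of_mem_closedRange {S T : Adjointable A H} {M : Submodule ℂ H}
    (hM : IsClosed (M : Set H)) (h : ∀ x, S.1 (T.1 x) ∈ M) {x : H} (hx : x ∈ closedRange T) :
    S.1 x ∈ M := by
  have h1 : closedRange T ≤ M.comap (S.1 : H →ₗ[ℂ] H) := by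
    refine Submodule.topologicalClosure_minimal _ ?_ (hM.preimage S.1.continuous)
    rintro _ ⟨y, rfl⟩
    exact h y
  exact h1 hx

theorem isClosed_closedRange (T : Adjointable A H) : IsClosed (closedRange T : Set H) :=
  Submodule.isClosed_topologicalClosure _

/-- Kernels need not be complemented in a Hilbert module, so the Hilbert space argument by
orthogonal complements is unavailable. Instead `T` is a norm limit of operators `T T⋆ z`. -/
theorem closedRange_mul_star (T : Adjointable A H) : closedRange (T * star T) = closedRange T := by
  refine le_antisymm (closedRange_mono (range_mul_le _ _)) ?_
  refine Submodule.topologicalClosure_minimal _ ?_ (isClosed_closedRange _)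
  rintro _ ⟨x, rfl⟩
  refine Metric.mem_closure_iff.mpr fun ε hε => ?_
  obtain ⟨z, hz⟩ := exists_norm_sub_mul_star_mul_le T
    (ε := (ε / (‖x‖ + 1)) ^ 2) (by positivity)
  refine ⟨(T * star T).1 (z.1 x), apply_mem_range _ _, ?_⟩
  have hz' : ‖T - T * star T * z‖ ≤ ε / (‖x‖ + 1) :=
    (sq_le_sq₀ (norm_nonneg _) (by positivity)).mp hz
  rw [dist_eq_norm]
  calc ‖T.1 x - (T * star T).1 (z.1 x)‖ = ‖(T - T * star T * z).1 x‖ := rfl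
    _ ≤ ‖T - T * star T * z‖ * ‖x‖ := (T - T * star T * z).1.le_opNorm x
    _ ≤ ε / (‖x‖ + 1) * ‖x‖ := by gcongr
    _ < ε / (‖x‖ + 1) * (‖x‖ + 1) := by gcongr; linarith
    _ = ε := by field_simp

theorem range_le_orthogonal {F : Adjointable A H} (hF : IsStarProjection F) (x : H) :
    x - F.1 x ∈ orthogonal A (range F) := by
  rintro _ ⟨y, rfl⟩
  have h1 : inner A (F.1 (x - F.1 x)) y = 0 := by
    have : F.1 (x - F.1 x) = 0 := by
      rw [map_sub, apply_eq_of_mem_range hF.isIdempotentElem (apply_mem_range F x), sub_self]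
    rw [this, CStarModule.inner_zero_left]
  rw [inner_adjoint, hF.isSelfAdjoint.star_eq] at h1
  exact h1

theorem isOrthogonallyComplemented_range {F : Adjointable A H} (hF : IsStarProjection F) :
    IsOrthogonallyComplemented A (range F) := by
  refine ⟨isClosed_range hF.isIdempotentElem, ?_⟩
  rw [eq_top_iff]
  intro x _
  rw [← add_sub_cancel (F.1 x) x]
  exact Submodule.add_mem_sup (apply_mem_range F x) (range_le_orthogonal hF x)

theorem norm_le_norm_of_inner_self_le {x y : H} (h : inner A x x ≤ inner A y y) : ‖x‖ ≤ ‖y‖ := by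
  refine (sq_le_sq₀ (norm_nonneg _) (norm_nonneg _)).mp ?_
  rw [CStarModule.norm_sq_eq A, CStarModule.norm_sq_eq A]
  exact CStarAlgebra.norm_le_norm_of_nonneg_of_le CStarModule.inner_self_nonneg h

/-- The Pythagorean inequality. -/
theorem norm_le_norm_add_of_inner_eq_zero {x y : H} (h : inner A y x = 0) : ‖x‖ ≤ ‖x + y‖ := by
  have h' : inner A x y = 0 := by rw [← CStarModule.star_inner, h, star_zero]
  refine norm_le_norm_of_inner_self_le (A := A) ?_
  rw [CStarModule.inner_add_left, CStarModule.inner_add_right, CStarModule.inner_add_right, h, h']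
  simpa using CStarModule.inner_self_nonneg

/-- An orthogonally complemented submodule is the range of a projection. -/
theorem IsOrthogonallyComplemented.exists_projection {M : Submodule ℂ H}
    (hM : IsOrthogonallyComplemented A M) :
    ∃ F : Adjointable A H, IsStarProjection F ∧ range F = M := by
  have hc : IsCompl M (orthogonal A M) := by
    refine ⟨Submodule.disjoint_def.mpr fun x hx hx' => CStarModule.inner_self.mp (hx' x hx),
      codisjoint_iff.mpr hM.2⟩
  set f := M.projection _ hc with hf
  have hfm : ∀ x, f x ∈ M := fun x => Submodule.projection_apply_mem hc x
  have hfo : ∀ x, x - f x ∈ orthogonal A M := fun x => by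
    rw [← Submodule.projection_apply_eq_zero_iff hc, map_sub,
      Submodule.projection_apply_of_mem_left hc (hfm x), sub_self]
  have hbd : ∀ x, ‖f x‖ ≤ 1 * ‖x‖ := fun x => by
    have := norm_le_norm_add_of_inner_eq_zero (A := A) (hfo x (f x) (hfm x))
    rwa [add_sub_cancel, ← one_mul ‖x‖] at this
  let g : H →L[ℂ] H := f.mkContinuous 1 hbd
  have hg : ∀ x, g x = f x := fun x => rfl
  have hgg : IsAdjointPair A H g g := by
    intro x y
    have h1 : inner A (f x) (y - f y) = 0 := by
      rw [← CStarModule.star_inner, hfo y _ (hfm x), star_zero]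
    have h2 : inner A (x - f x) (f y) = 0 := hfo x _ (hfm y)
    rw [CStarModule.inner_sub_right, sub_eq_zero] at h1
    rw [CStarModule.inner_sub_left, sub_eq_zero] at h2
    rw [hg, hg, h1, h2]
  let F : Adjointable A H := ⟨g, g, hgg⟩
  refine ⟨F, ⟨Subtype.ext (ContinuousLinearMap.ext fun x => ?_), Adjointable.star_eq hgg⟩, ?_⟩
  · exact Submodule.projection_apply_of_mem_left hc (hfm x)
  · exact Submodule.range_projection hc

/-- A criterion for the polar decomposition: `T = C W` with `C ≥ 0` and `W W⋆` the projection onto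
the closure of the range of `C`. -/
theorem hasPolarDecomposition_of_eq_mul {T C W F : Adjointable A H} (hC : 0 ≤ C) (hT : T = C * W)
    (hW : W * star W = F) (hF : IsStarProjection F) (hr : range F = closedRange C) :
    HasPolarDecomposition T := by
  have hFC : F * C = C := mul_eq_of_closedRange hF.isIdempotentElem hr
  have hCs : star C = C := hC.isSelfAdjoint.star_eq
  have hFs : star F = F := hF.isSelfAdjoint
  have hFF : F * F = F := hF.isIdempotentElem
  have hFW : F * W = W := by
    have h1 : (F * W - W) * star (F * W - W) = 0 := by
      rw [star_sub, star_mul, hFs, mul_sub, sub_mul, sub_mul, ← mul_assoc, mul_assoc F W, hW,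
        ← mul_assoc, hW, hFF, hFF]
      simp
    exact sub_eq_zero.mp (CStarRing.mul_star_self_eq_zero_iff _ |>.mp h1)
  have hTs : star T = star W * C := by rw [hT, star_mul, hCs]
  -- The candidate is positive and its square is `W⋆ C F C W = W⋆ C² W = T⋆ T`. Consequently `W`
  -- itself is the partial isometry of the decomposition.
  have habs : CFC.abs T = star W * C * W := by
    refine CFC.sqrt_unique ?_ (star_left_conjugate_nonneg hC W)
    rw [hTs, hT]
    calc star W * C * W * (star W * C * W) = star W * C * (W * star W * C) * W := by
          simp only [mul_assoc]
      _ = star W * C * (C * W) := by rw [hW, hFC]; simp only [mul_assoc]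
  have hWWW : W * star W * W = W := by rw [hW, hFW]
  have hproj : IsStarProjection (star W * W) := by
    refine ⟨?_, ?_⟩
    · show star W * W * (star W * W) = star W * W
      rw [mul_assoc, ← mul_assoc W, hWWW]
    · rw [isSelfAdjoint_iff, star_mul, star_star]
  refine ⟨W, hWWW, ?_, hproj, le_antisymm ?_ ?_⟩
  · rw [habs, ← mul_assoc, ← mul_assoc, hW, hFC, hT]
  · rintro _ ⟨x, rfl⟩
    have h1 : (star W * W).1 x = (star W).1 (F.1 (W.1 x)) := by
      change (star W).1 (W.1 x) = (star W).1 ((F * W).1 x)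
      rw [hFW]
    change (star W * W).1 x ∈ _
    rw [h1]
    refine apply_mem_of_mem_closedRange (T := C) (isClosed_closedRange _) (fun y => ?_)
      (hr ▸ apply_mem_range F _)
    rw [hTs]
    exact range_le_closedRange _ (apply_mem_range (star W * C) y)
  · refine closedRange_le_range hproj.isIdempotentElem ?_
    rw [hTs, mul_assoc, ← mul_assoc W, hW, hFC]

/-- An operator with the polar decomposition has an orthogonally complemented closed range. -/
theorem HasPolarDecomposition.isOrthogonallyComplemented {T : Adjointable A H}
    (hT : HasPolarDecomposition T) : IsOrthogonallyComplemented A (closedRange T) := by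
  obtain ⟨U, hU, hTU, -, hr⟩ := hT
  have habs : star (CFC.abs T) = CFC.abs T := (CFC.abs_nonneg T).isSelfAdjoint.star_eq
  have hproj : IsStarProjection (U * star U) := by
    refine ⟨?_, ?_⟩
    · show U * star U * (U * star U) = U * star U
      rw [← mul_assoc, hU]
    · rw [isSelfAdjoint_iff, star_mul, star_star]
  -- Both sides equal `U |T| U⋆`. The identity shows that `U` carries the closed range of `T⋆` into
  -- that of `T`.
  have hTs : U * star T = T * star U := by
    nth_rewrite 1 [hTU]
    nth_rewrite 2 [hTU]
    rw [star_mul, habs, mul_assoc]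
  have : closedRange T = range (U * star U) := by
    refine le_antisymm ?_ ?_
    · refine closedRange_le_range hproj.isIdempotentElem ?_
      nth_rewrite 1 [hTU]
      rw [← mul_assoc, hU, ← hTU]
    · rintro _ ⟨x, rfl⟩
      change U.1 ((star U).1 x) ∈ _
      have h1 : (star U).1 x = (star U * U).1 ((star U).1 x) := by
        have : star U * U * star U = star U := by
          conv_rhs => rw [← hU]
          simp only [star_mul, star_star, mul_assoc]
        exact congrArg (fun T : Adjointable A H => T.1 x) this.symm
      rw [h1]
      refine apply_mem_of_mem_closedRange (T := star T) (isClosed_closedRange _) (fun y => ?_)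
        (hr ▸ apply_mem_range (star U * U) _)
      change (U * star T).1 y ∈ _
      rw [hTs]
      exact range_le_closedRange _ (range_mul_le _ _ (apply_mem_range (T * star U) y))
  rw [this]
  exact isOrthogonallyComplemented_range hproj

/-- Extension of the isometry `C w ↦ Y w` by zero. -/
theorem exists_extension {C Y G : Adjointable A H} (h : star C * C = star Y * Y)
    (hG : IsStarProjection G) (hGC : range G = closedRange C) :
    ∃ U : H →L[ℂ] H, (∀ w, U (C.1 w) = Y.1 w) ∧ ∀ w, U (w - G.1 w) = 0 := by
  -- The map `(w, w') ↦ C w + (1 - G) w'` has dense range because `G` projects onto the closed range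
  -- of `C`. By the Pythagorean inequality, `(w, w') ↦ Y w` factors contractively through it.
  let e : H × H →ₗ[ℂ] H := (C.1 : H →ₗ[ℂ] H).coprod
    ((1 - G).1 : H →ₗ[ℂ] H)
  let f : H × H →ₗ[ℂ] H := (Y.1 : H →ₗ[ℂ] H) ∘ₗ LinearMap.fst ℂ H H
  have he : ∀ w w', e (w, w') = C.1 w + (w' - G.1 w') := fun _ _ => rfl
  have hf : ∀ w w', f (w, w') = Y.1 w := fun _ _ => rfl
  have hd : DenseRange e := by
    intro x
    have h1 : closedRange C ≤ (LinearMap.range e).topologicalClosure := by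
      refine Submodule.topologicalClosure_mono ?_
      rintro _ ⟨w, rfl⟩
      exact ⟨(w, 0), by rw [he]; simp⟩
    have h2 : x - G.1 x ∈ (LinearMap.range e).topologicalClosure :=
      Submodule.le_topologicalClosure _ ⟨(0, x), by rw [he]; simp⟩
    have h3 := Submodule.add_mem _ (h1 (hGC ▸ apply_mem_range G x)) h2
    rw [add_sub_cancel] at h3
    exact h3
  have hn : ∀ x, ‖f x‖ ≤ 1 * ‖e x‖ := by
    rintro ⟨w, w'⟩
    rw [he, hf, one_mul]
    have h1 : ‖Y.1 w‖ ≤ ‖C.1 w‖ := by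
      refine norm_le_norm_of_inner_self_le (A := A) (le_of_eq ?_)
      rw [inner_adjoint, inner_adjoint]
      change inner A w ((star Y * Y).1 w) = inner A w ((star C * C).1 w)
      rw [h]
    refine h1.trans (norm_le_norm_add_of_inner_eq_zero (A := A) ?_)
    exact range_le_orthogonal hG w' _ (hGC ▸ range_le_closedRange C (apply_mem_range C w))
  refine ⟨f.extendOfNorm e, fun w => ?_, fun w => ?_⟩
  · have := LinearMap.extendOfNorm_eq hd ⟨1, hn⟩ (w, 0)
    rwa [he, hf, map_zero, sub_zero, add_zero] at this
  · have := LinearMap.extendOfNorm_eq hd ⟨1, hn⟩ (0, w)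
    rwa [he, hf, map_zero, zero_add, map_zero] at this

/-- Two bounded maps agree if they agree on `C w` and on `w - G w`. -/
theorem eq_of_eq_on_range {E : Type*} [TopologicalSpace E] [T2Space E] [AddCommGroup E]
    {C G : Adjointable A H} (hGC : range G = closedRange C) {f g : H → E} (hf : Continuous f)
    (hg : Continuous g) (hfa : ∀ x y, f (x + y) = f x + f y) (hga : ∀ x y, g (x + y) = g x + g y)
    (h1 : ∀ w, f (C.1 w) = g (C.1 w)) (h2 : ∀ w, f (w - G.1 w) = g (w - G.1 w)) (x : H) :
    f x = g x := by
  have h3 : (closedRange C : Set H) ⊆ {x | f x = g x} := by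
    refine closure_minimal ?_ (isClosed_eq hf hg)
    rintro _ ⟨w, rfl⟩
    exact h1 w
  rw [← add_sub_cancel (G.1 x) x, hfa, hga, h2, h3 (hGC ▸ apply_mem_range G x)]

/-- If `C⋆C = Y⋆Y` and the closed ranges of `C` and `Y` are complemented, then `Y = U C` for a
partial isometry `U` between these ranges. -/
theorem exists_partialIsometry {C Y F G : Adjointable A H} (h : star C * C = star Y * Y)
    (hG : IsStarProjection G) (hGC : range G = closedRange C)
    (hF : IsStarProjection F) (hFY : range F = closedRange Y) :
    ∃ U : Adjointable A H, Y = U * C ∧ star U * U = G ∧ F * U = U := by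
  obtain ⟨U, hU1, hU2⟩ := exists_extension h hG hGC
  obtain ⟨V, hV1, hV2⟩ := exists_extension h.symm hF hFY
  have hCY : ∀ w v, inner A (Y.1 w) (Y.1 v) = inner A (C.1 w) (C.1 v) := fun w v => by
    rw [inner_adjoint, inner_adjoint]
    change inner A w ((star Y * Y).1 v) = inner A w ((star C * C).1 v)
    rw [h]
  have cinl : ∀ y : H, Continuous fun x : H => inner A x y := fun y =>
    (CStarModule.continuous_inner (A := A) (E := H)).comp (continuous_id.prodMk continuous_const)
  have cinr : ∀ y : H, Continuous fun x : H => inner A y x := fun y =>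
    (CStarModule.continuous_inner (A := A) (E := H)).comp (continuous_const.prodMk continuous_id)
  have hGo : ∀ w v, inner A (w - G.1 w) (C.1 v) = 0 := fun w v =>
    range_le_orthogonal hG w _ (hGC ▸ range_le_closedRange C (apply_mem_range C v))
  have hFo : ∀ w v, inner A (Y.1 v) (w - F.1 w) = 0 := fun w v => by
    rw [← CStarModule.star_inner, range_le_orthogonal hF w _
      (hFY ▸ range_le_closedRange Y (apply_mem_range Y v)), star_zero]
  -- Boundedness does not give an adjoint here. The extension `V` of the inverse isometry `Y w ↦ C
  -- w` is the adjoint of `U`; its construction needs the closed range of `Y` complemented as well.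
  have hUV : IsAdjointPair A H U V := by
    intro x y
    refine eq_of_eq_on_range hGC (f := fun x => inner A (U x) y) (g := fun x => inner A x (V y))
      ((cinl y).comp U.continuous) (cinl _) (by simp) (by simp) (fun w => ?_) (fun w => ?_) x
    · refine eq_of_eq_on_range hFY (f := fun y => inner A (U (C.1 w)) y)
        (g := fun y => inner A (C.1 w) (V y)) (cinr _) ((cinr _).comp V.continuous) (by simp)
        (by simp) (fun v => ?_) (fun v => ?_) y
      · simp only [hU1, hV1, hCY]
      · simp only [hU1, hV2, hFo, CStarModule.inner_zero_right]
    · refine eq_of_eq_on_range hFY (f := fun y => inner A (U (w - G.1 w)) y)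
        (g := fun y => inner A (w - G.1 w) (V y)) (cinr _) ((cinr _).comp V.continuous) (by simp)
        (by simp) (fun v => ?_) (fun v => ?_) y
      · simp only [hU2, hV1, hGo, CStarModule.inner_zero_left]
      · simp only [hU2, hV2, CStarModule.inner_zero_left, CStarModule.inner_zero_right]
  let U' : Adjointable A H := ⟨U, V, hUV⟩
  have hs : (star U').1 = V := hUV.unique U'.isAdjointPair |>.symm
  refine ⟨U', ?_, ?_, ?_⟩
  · exact Subtype.ext (ContinuousLinearMap.ext fun w => (hU1 w).symm)
  · refine Subtype.ext (ContinuousLinearMap.ext fun x => ?_)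
    change (star U').1 (U x) = G.1 x
    rw [hs]
    refine eq_of_eq_on_range hGC (f := fun x => V (U x)) (g := fun x => G.1 x)
      (V.continuous.comp U.continuous) G.1.continuous (by simp) (by simp) (fun w => ?_)
      (fun w => ?_) x
    · simp only [hU1, hV1]
      exact (apply_eq_of_mem_range hG.isIdempotentElem
        (hGC ▸ range_le_closedRange C (apply_mem_range C w))).symm
    · simp only [hU2, map_zero, map_sub]
      rw [apply_eq_of_mem_range hG.isIdempotentElem (apply_mem_range G w), sub_self]
  · refine Subtype.ext (ContinuousLinearMap.ext fun x => ?_)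
    change F.1 (U x) = U x
    refine eq_of_eq_on_range hGC (f := fun x => F.1 (U x)) (g := fun x => U x)
      (F.1.continuous.comp U.continuous) U.continuous (by simp) (by simp) (fun w => ?_)
      (fun w => ?_) x
    · simp only [hU1]
      exact apply_eq_of_mem_range hF.isIdempotentElem
        (hFY ▸ range_le_closedRange Y (apply_mem_range Y w))
    · simp only [hU2, map_zero]

end Modules
end HilbertCStar
end

noncomputable section
namespace HilbertCStar

/-! ### Block computations for quasi-projection pairs. -/

section QuasiProjectionPairs

variable {A H : Type*} [NonUnitalCStarAlgebra A] [PartialOrder A] [StarOrderedRing A]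
  [NormedAddCommGroup H] [NormedSpace ℂ H] [CompleteSpace H] [SMul A H] [CStarModule A H]
  {P Q : Adjointable A H}

theorem mul_one_sub_mul {R : Type*} [Ring R] (p x r : R) : p * (1 - x) * r = p * r - p * x * r := by
  rw [mul_sub, mul_one, sub_mul]

theorem IsQuasiProjectionPair.one_sub_left (h : IsQuasiProjectionPair P Q) :
    IsQuasiProjectionPair (1 - P) Q where
  isStarProjection := h.isStarProjection.one_sub
  isIdempotentElem := h.isIdempotentElem
  corner_left := h.corner_right
  off_diagonal := by
    have := congrArg star h.off_diagonal
    simp only [star_mul, star_sub, star_one, star_neg, star_star,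
      h.isStarProjection.isSelfAdjoint.star_eq, ← mul_assoc] at this
    rw [sub_sub_cancel, this, neg_neg]
  corner_right := by
    rw [sub_sub_cancel, h.corner_left]

theorem IsQuasiProjectionPair.one_sub_right (h : IsQuasiProjectionPair P Q) :
    IsQuasiProjectionPair P (1 - Q) := by
  have h1 : P * (1 - P) = 0 := h.isStarProjection.isIdempotentElem.mul_one_sub_self
  refine ⟨h.isStarProjection, h.isIdempotentElem.one_sub, ?_, ?_, ?_⟩ <;>
    rw [star_sub, star_one, mul_one_sub_mul, mul_one_sub_mul]
  · rw [h.corner_left]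
  · rw [h.off_diagonal, h1, zero_sub, zero_sub]
  · rw [h.corner_right]

/-- The blocks of a quasi-projection pair in terms of `K = P Q P - P` and `Y = P Q (1 - P)`. -/
theorem IsQuasiProjectionPair.blocks (h : IsQuasiProjectionPair P Q) {K Y : Adjointable A H}
    (hK : K = P * Q * P - P) (hY : Y = P * Q * (1 - P)) :
    P * K = K ∧ K * P = K ∧ star Y = -((1 - P) * Q * P) ∧ Y * P = 0 ∧
      Y * star Y = K * (1 + K) := by
  have hP : P * P = P := h.isStarProjection.isIdempotentElem
  have hPs : star P = P := h.isStarProjection.isSelfAdjoint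
  have hQ : Q * Q = Q := h.isIdempotentElem
  have hP' : ∀ x, P * (P * x) = P * x := fun x => by rw [← mul_assoc, hP]
  have hQ' : ∀ x, Q * (Q * x) = Q * x := fun x => by rw [← mul_assoc, hQ]
  have hYs : star Y = -((1 - P) * Q * P) := by
    have := congrArg star h.off_diagonal
    simp only [star_mul, star_sub, star_one, star_neg, star_star, hPs] at this
    rw [hY]
    simp only [star_mul, star_sub, star_one, hPs]
    rw [mul_assoc, this, neg_neg]
  refine ⟨?_, ?_, hYs, ?_, ?_⟩
  · rw [hK]; simp only [mul_sub, mul_assoc, hP, hP']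
  · rw [hK]; simp only [sub_mul, mul_assoc, hP]
  · rw [hY]; simp only [mul_sub, sub_mul, mul_one, mul_assoc, hP, sub_self]
  -- Since `Q² = Q`, `Y Y⋆ = -P Q (1 - P) Q P = (P Q P)² - P Q P`, and `P Q P = K + P`.
  · rw [hYs, hY, hK]
    simp only [mul_sub, sub_mul, mul_add, one_mul, mul_one, mul_neg, mul_assoc, hP, hP', hQ']
    abel

/-- The closed ranges of `P (1 - Q)` and of `P Q (1 - P)` agree if `P Q P ≥ P`. -/
theorem IsQuasiProjectionPair.closedRanges (h : IsQuasiProjectionPair P Q)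
    {K Y : Adjointable A H} (hK : K = P * Q * P - P) (hY : Y = P * Q * (1 - P)) (hK0 : 0 ≤ K) :
    closedRange Y = closedRange K ∧ closedRange (P * (1 - Q)) = closedRange K := by
  obtain ⟨hPK, hKP, hYs, hYP, hYY⟩ := h.blocks hK hY
  have hKs : star K = K := hK0.isSelfAdjoint.star_eq
  obtain ⟨Z, -, -, hZ, -⟩ := exists_nonneg_inverse hK0
  obtain ⟨Z', -, -, hZ', -⟩ := exists_nonneg_inverse (add_nonneg hK0 hK0)
  have hT : P * (1 - Q) = -(K + Y) := by
    rw [hK, hY, mul_sub, mul_sub, mul_one, mul_one]; abel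
  have hKY : K * star Y = 0 := by
    rw [← hKs, ← star_mul, ← hPK, ← mul_assoc, hYP, zero_mul, star_zero]
  have hYK : Y * K = 0 := by rw [← hPK, ← mul_assoc, hYP, zero_mul]
  refine ⟨?_, ?_⟩
  · rw [← closedRange_mul_star, hYY, closedRange_mul_of_rightInverse hZ]
  · rw [hT, closedRange_neg, ← closedRange_mul_star]
    have : (K + Y) * star (K + Y) = K * (1 + (K + K)) := by
      rw [star_add, hKs, add_mul, mul_add, mul_add, hKY, hYK, hYY]
      simp only [mul_add, mul_one]
      abel
    rw [this, closedRange_mul_of_rightInverse hZ']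

/-- `P Q` has the polar decomposition if `P Q P ≥ P`. -/
theorem IsQuasiProjectionPair.hasPolarDecomposition_mul (h : IsQuasiProjectionPair P Q)
    (hK0 : 0 ≤ P * Q * P - P) : HasPolarDecomposition (P * Q) := by
  obtain ⟨K, hK⟩ : ∃ K, K = P * Q * P - P := ⟨_, rfl⟩
  obtain ⟨Y, hY⟩ : ∃ Y, Y = P * Q * (1 - P) := ⟨_, rfl⟩
  rw [← hK] at hK0
  obtain ⟨hPK, hKP, hYs, hYP, hYY⟩ := h.blocks hK hY
  have hKs : star K = K := hK0.isSelfAdjoint.star_eq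
  have hP : P * P = P := h.isStarProjection.isIdempotentElem
  have hPs : star P = P := h.isStarProjection.isSelfAdjoint
  have hD0 : 0 ≤ K + K + K + (K * K + K * K) := by
    have : 0 ≤ K * K := by nth_rewrite 1 [← hKs]; exact star_mul_self_nonneg K
    positivity
  -- On the corner of `P`, `P Q (P Q)⋆ = (K + P)² + Y Y⋆`, which is `P + 3K + 2K² = (1 + D) P`.
  set D := K + K + K + (K * K + K * K) with hD
  have hDc : ∀ x, Commute K x → Commute D x := fun x hx =>
    ((hx.add_left hx).add_left hx).add_left ((hx.mul_left hx).add_left (hx.mul_left hx))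
  obtain ⟨L, hL0, hLL, hLc⟩ := exists_nonneg_sqrt (add_nonneg zero_le_one hD0)
  obtain ⟨Z, hZ0, hZ1, hZ2, hZc⟩ := exists_nonneg_inverse hD0
  have hDP : Commute D P := hDc P (hKP.trans hPK.symm)
  have hLP : L * P = P * L := hLc P ((Commute.one_left P).add_left hDP)
  have hZP : Z * P = P * Z := hZc P hDP
  have hLZ : Commute L Z := hLc Z ((Commute.one_left Z).add_left (hZc D (Commute.refl _)).symm)
  have hLs : star L = L := hL0.isSelfAdjoint.star_eq
  have hZs : star Z = Z := hZ0.isSelfAdjoint.star_eq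
  have hPQ : P * Q = K + P + Y := by rw [hK, hY, mul_sub, mul_one]; abel
  have hPYs : P * star Y = 0 := by rw [← hPs, ← star_mul, hYP, star_zero]
  have hKYs : K * star Y = 0 := by rw [← hKP, mul_assoc, hPYs, mul_zero]
  have hYK : Y * K = 0 := by rw [← hPK, ← mul_assoc, hYP, zero_mul]
  have hTT : P * Q * star (P * Q) = (1 + D) * P := by
    rw [hPQ, star_add, star_add, hKs, hPs, hD]
    simp only [add_mul, mul_add, hP, hPK, hKP, hPYs, hKYs, hYK, hYP, hYY, one_mul, mul_one,
      mul_assoc]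
    abel
  -- Here `Z L = (1 + D)^(-1/2)`, so `W` is `P Q` normalised on the left.
  refine hasPolarDecomposition_of_eq_mul (C := L * P) (W := Z * L * (P * Q)) (F := P)
    (Commute.mul_nonneg hL0 h.isStarProjection.nonneg hLP) ?_ ?_ h.isStarProjection ?_
  · calc P * Q = P * (P * Q) := by rw [← mul_assoc, hP]
      _ = ((1 + D) * Z) * (P * (P * Q)) := by rw [hZ2, one_mul]
      _ = L * (L * (Z * P)) * (P * Q) := by rw [← hLL]; simp only [mul_assoc]
      _ = L * P * (Z * L * (P * Q)) := by
        rw [hZP, ← mul_assoc L P Z, ← hLZ.eq, hLP]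
        simp only [mul_assoc]
        rw [← mul_assoc L P, hLP]
        simp only [mul_assoc]
  · calc Z * L * (P * Q) * star (Z * L * (P * Q))
        = Z * L * (P * Q * star (P * Q)) * (L * Z) := by
          rw [star_mul (Z * L), star_mul Z, hLs, hZs]; simp only [mul_assoc]
      _ = Z * L * (L * L) * (P * L) * Z := by rw [hTT, ← hLL]; simp only [mul_assoc]
      _ = Z * (L * L) * ((L * L) * (P * Z)) := by rw [← hLP]; simp only [mul_assoc]
      _ = P := by
        rw [hLL, hZ1, one_mul, ← hZP, ← mul_assoc, hZ2, one_mul]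
  · have hinv : L * (L * Z) = 1 := by rw [← mul_assoc, hLL, hZ2]
    rw [hLP, closedRange_mul_of_rightInverse hinv, closedRange_eq_range hP]

/-- `P (1 - Q)` has the polar decomposition if `P Q P ≥ P` and the closed ranges of both
off-diagonal blocks are complemented. -/
theorem IsQuasiProjectionPair.hasPolarDecomposition_mul_one_sub (h : IsQuasiProjectionPair P Q)
    (hK0 : 0 ≤ P * Q * P - P)
    (h1 : IsOrthogonallyComplemented A (closedRange (P * Q * (1 - P))))
    (h2 : IsOrthogonallyComplemented A (closedRange ((1 - P) * Q * P))) :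
    HasPolarDecomposition (P * (1 - Q)) := by
  obtain ⟨K, hK⟩ : ∃ K, K = P * Q * P - P := ⟨_, rfl⟩
  obtain ⟨Y, hY⟩ : ∃ Y, Y = P * Q * (1 - P) := ⟨_, rfl⟩
  rw [← hK] at hK0
  obtain ⟨hPK, hKP, hYs, hYP, hYY⟩ := h.blocks hK hY
  have hYK := (h.closedRanges hK hY hK0).1
  rw [← hY] at h1
  rw [← closedRange_neg, ← hYs] at h2
  obtain ⟨F, hF, hFY⟩ := h1.exists_projection
  obtain ⟨G, hG, hGY⟩ := h2.exists_projection
  have hFF : F * F = F := hF.isIdempotentElem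
  have hFs : star F = F := hF.isSelfAdjoint
  have hPs : star P = P := h.isStarProjection.isSelfAdjoint
  have hKs : star K = K := hK0.isSelfAdjoint.star_eq
  -- `R`, `S` and `L` are the square roots of `K`, `1 + K` and `1 + 2K`, and `Z = (1 + 2K)⁻¹`. All
  -- are obtained from `K`, so they commute with whatever `K` commutes with.
  obtain ⟨R, hR0, hRR, hRc⟩ := exists_nonneg_sqrt hK0
  obtain ⟨S, hS0, hSS, hSc⟩ := exists_nonneg_sqrt (add_nonneg zero_le_one hK0)
  obtain ⟨L, hL0, hLL, hLc⟩ :=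
    exists_nonneg_sqrt (add_nonneg zero_le_one (add_nonneg hK0 hK0))
  obtain ⟨Z, hZ0, hZ1, hZ2, hZc⟩ := exists_nonneg_inverse (add_nonneg hK0 hK0)
  obtain ⟨Z', -, -, hZ', -⟩ := exists_nonneg_inverse hK0
  have hRs : star R = R := hR0.isSelfAdjoint.star_eq
  have hSs : star S = S := hS0.isSelfAdjoint.star_eq
  have hLs : star L = L := hL0.isSelfAdjoint.star_eq
  have hZs : star Z = Z := hZ0.isSelfAdjoint.star_eq
  have hSc' : ∀ x, Commute K x → Commute S x := fun x hx => hSc x ((Commute.one_left x).add_left hx)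
  have hLc' : ∀ x, Commute K x → Commute L x := fun x hx =>
    hLc x ((Commute.one_left x).add_left (hx.add_left hx))
  have hZc' : ∀ x, Commute K x → Commute Z x := fun x hx => hZc x (hx.add_left hx)
  have hKR : Commute K R := (hRc K (Commute.refl K)).symm
  have hKL : Commute K L := (hLc' K (Commute.refl K)).symm
  have hSR : S * R = R * S := hSc' R hKR
  have hLR : L * R = R * L := hLc' R hKR
  have hZL : Z * L = L * Z := hZc' L hKL
  have hcR : closedRange R = closedRange K := by
    rw [← hRR]; nth_rewrite 3 [← hRs]; rw [closedRange_mul_star]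
  have hSinv : S * (S * Z') = 1 := by rw [← mul_assoc, hSS, hZ']
  have hLinv : L * (L * Z) = 1 := by rw [← mul_assoc, hLL, hZ2]
  have hcRS : closedRange (R * S) = closedRange K := by
    rw [closedRange_mul_of_rightInverse hSinv, hcR]
  have hcRL : closedRange (R * L) = closedRange K := by
    rw [closedRange_mul_of_rightInverse hLinv, hcR]
  have hFR : F * R = R := mul_eq_of_closedRange hFF (by rw [hFY, hYK, hcR])
  have hRF : R * F = R := by rw [← hRs, ← hFs, ← star_mul, hFR]
  have hFK : F * K = K := by rw [← hRR, ← mul_assoc, hFR]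
  have hKF : K * F = K := by rw [← hRR, mul_assoc, hRF]
  have hcF : Commute K F := hKF.trans hFK.symm
  have hSF : S * F = F * S := hSc' F hcF
  have hLF : L * F = F * L := hLc' F hcF
  have hZF : Z * F = F * Z := hZc' F hcF
  have hRSs : star (R * S) = R * S := by rw [star_mul, hRs, hSs, hSR]
  have hCC : star (R * S) * (R * S) = star (star Y) * star Y := by
    rw [star_star, hYY, hRSs, ← hSS, ← hRR]
    calc R * S * (R * S) = R * (S * R) * S := by simp only [mul_assoc]
      _ = R * R * (S * S) := by rw [hSR]; simp only [mul_assoc]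
  -- Both `R S` and `Y⋆` have modulus squared `K (1 + K)`, so `Y⋆ = V R S`; complementedness of both
  -- closed ranges is used here.
  obtain ⟨V, hV, hVV, hGV⟩ := exists_partialIsometry hCC hF
    (by rw [hcRS, hFY, hYK]) hG hGY
  have hYV : Y = R * S * star V := by
    rw [← star_star Y, hV, star_mul, hRSs]
  have hPG : P * G = 0 := by
    refine Subtype.ext (ContinuousLinearMap.ext fun x => ?_)
    have hPYs : P * star Y = 0 := by rw [← hPs, ← star_mul, hYP, star_zero]
    have : P.1 (G.1 x) ∈ (⊥ : Submodule ℂ H) := by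
      refine apply_mem_of_mem_closedRange (T := star Y) isClosed_singleton (fun y => ?_)
        (hGY ▸ apply_mem_range G x)
      exact congrArg (fun T : Adjointable A H => T.1 y) hPYs
    exact this
  have hRP : R * P = R := by
    have hcP : R * P = P * R := hRc P (hKP.trans hPK.symm)
    have h3 : (R * P - R) * star (R * P - R) = 0 := by
      rw [star_sub, star_mul, hRs, hPs, ← hcP, sub_mul, mul_sub, mul_sub]
      have h4 : R * P * R = K := by rw [hcP, mul_assoc, hRR, hPK]
      rw [← mul_assoc, h4, ← mul_assoc, hRR, hKP]
      simp
    exact sub_eq_zero.mp (CStarRing.mul_star_self_eq_zero_iff _ |>.mp h3)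
  -- `V` maps into the closed range of `Y⋆`, which `P` annihilates, while `R = R P`. This removes
  -- the cross terms in `hN`, leaving `K + (1 + K) F = (1 + 2K) F`.
  have hRV : R * V = 0 := by
    rw [← hGV, ← hRP, mul_assoc, ← mul_assoc P, hPG, zero_mul, mul_zero]
  have hVR : star V * R = 0 := by rw [← hRs, ← star_mul, hRV, star_zero]
  have hT : P * (1 - Q) = -(R * (R + S * star V)) := by
    rw [mul_add, hRR, ← mul_assoc, ← hYV, hK, hY, mul_sub, mul_sub, mul_one, mul_one]; abel
  have hN : (R + S * star V) * star (R + S * star V) = (1 + (K + K)) * F := by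
    rw [star_add, star_mul, star_star, hRs, hSs]
    calc (R + S * star V) * (R + V * S)
        = R * R + R * V * S + S * (star V * R) + S * (star V * V) * S := by
          simp only [add_mul, mul_add, mul_assoc]; abel
      _ = (1 + (K + K)) * F := by
          rw [hRV, hVR, hVV, hSF, mul_assoc, hSS, hRR]
          simp only [add_mul, mul_add, hKF, hFK, one_mul, mul_one, zero_mul, mul_zero]
          abel
  refine hasPolarDecomposition_of_eq_mul (C := R * L) (W := -(Z * L * (R + S * star V))) (F := F)
    (Commute.mul_nonneg hR0 hL0 hLR.symm) ?_ ?_ hF (by rw [hFY, hYK, hcRL])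
  · rw [hT, mul_neg]
    congr 1
    calc R * (R + S * star V) = R * (((1 + (K + K)) * Z) * (R + S * star V)) := by
          rw [hZ2, one_mul]
      _ = R * (L * (L * Z) * (R + S * star V)) := by rw [← hLL]; simp only [mul_assoc]
      _ = R * L * (Z * L * (R + S * star V)) := by rw [← hZL]; simp only [mul_assoc]
  · rw [star_neg, neg_mul_neg]
    calc Z * L * (R + S * star V) * star (Z * L * (R + S * star V))
        = Z * L * ((R + S * star V) * star (R + S * star V)) * (L * Z) := by
          rw [star_mul (Z * L), star_mul Z, hLs, hZs]; simp only [mul_assoc]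
      _ = Z * L * (L * L) * (F * L) * Z := by rw [hN, ← hLL]; simp only [mul_assoc]
      _ = Z * (L * L) * ((L * L) * (F * Z)) := by rw [← hLF]; simp only [mul_assoc]
      _ = F := by
        rw [hLL, hZ1, one_mul, ← hZF, ← mul_assoc, hZ2, one_mul]

/-! ### The matched pair and the theorem. -/

theorem moorePenroseInverse_eq {T X : Adjointable A H}
    (h : IsMoorePenroseInverse T X) : moorePenroseInverse T = X := by
  have h' : ∃ X, IsMoorePenroseInverse T X := ⟨X, h⟩
  rw [moorePenroseInverse, dif_pos h']
  exact h'.choose_spec.unique h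

/-- The matched pair of an idempotent is a quasi-projection pair whose corners satisfy
`P Q P ≥ P` and `(1 - P) (1 - Q) (1 - P) ≥ 1 - P`. -/
theorem matchedProjection_spec (hQ : IsIdempotentElem Q) {P : Adjointable A H}
    (hP : P = matchedProjection Q) :
    IsQuasiProjectionPair P Q ∧ 0 ≤ P * Q * P - P ∧
      0 ≤ (1 - P) * (1 - Q) * (1 - P) - (1 - P) := by
  obtain ⟨e, he, hqe, heq⟩ := exists_range_projection hQ
  obtain ⟨hea, hae, c, c0, hac, hca, hce, hec⟩ := exists_corner_inverse he hqe heq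
  have a0 : 0 ≤ CFC.abs (star Q) := CFC.abs_nonneg _
  have aa : CFC.abs (star Q) * CFC.abs (star Q) = Q * star Q := by
    simpa using CFC.abs_mul_abs (star Q)
  -- The corner inverse satisfies the Penrose equations, so the default value `0` does not occur.
  have hmp : moorePenroseInverse (CFC.abs (star Q)) = c :=
    moorePenroseInverse_eq
      ⟨by rw [hac, hea], by rw [hca, hec], by rw [hac]; exact he.isSelfAdjoint,
        by rw [hca]; exact he.isSelfAdjoint⟩
  rw [matchedProjection, hmp] at hP
  obtain ⟨hPp, hQP, hpos⟩ := matched_projection_properties he hqe heq a0 aa hea hae c0 hac hca hce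
    hec hQ hP
  generalize CFC.abs (star Q) = a at a0 hQP
  have hPP : P * P = P := hPp.isIdempotentElem
  have hPs : star P = P := hPp.isSelfAdjoint
  have h2 : Q * P + Q * P = a + Q := by
    rw [hQP, ← add_smul]; norm_num
  have has : star a = a := a0.isSelfAdjoint.star_eq
  -- `2P - 1` is a symmetry with `Q (2P - 1) = a`. It acts as `1` on the range of `P` and as `-1` on
  -- that of `1 - P`, from which all block identities are read off.
  have hQa : Q = a * (P + P - 1) := by
    have h3 : Q * (P + P - 1) = a := by rw [mul_sub, mul_add, h2]; simp
    have h4 : (P + P - 1) * (P + P - 1) = 1 := by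
      simp only [mul_sub, sub_mul, mul_add, add_mul, hPP, mul_one, one_mul]; abel
    rw [← h3, mul_assoc, h4, mul_one]
  have hQsa : star Q = (P + P - 1) * a := by
    rw [hQa]; simp [star_mul, hPs, has]
  have r1 : (P + P - 1) * P = P := by
    simp only [sub_mul, add_mul, hPP, one_mul]; abel
  have l1 : P * (P + P - 1) = P := by
    simp only [mul_sub, mul_add, hPP, mul_one]; abel
  have r2 : (P + P - 1) * (1 - P) = -(1 - P) := by rw [mul_sub, r1]; simp only [mul_one]; abel
  have l2 : (1 - P) * (P + P - 1) = -(1 - P) := by rw [sub_mul, l1]; simp only [one_mul]; abel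
  have b1 : P * Q * P = P * a * P := by rw [hQa]; simp only [mul_assoc, r1]
  have b2 : (1 - P) * Q * (1 - P) = -((1 - P) * a * (1 - P)) := by
    rw [hQa]; simp only [mul_assoc, r2, mul_neg]
  refine ⟨⟨hPp, hQ, ?_, ?_, ?_⟩, hpos, ?_⟩
  · rw [b1, hQsa, ← mul_assoc, l1]
  · rw [hQsa, ← mul_assoc, l1, hQa]
    simp only [mul_assoc, r2, mul_neg, neg_neg]
  · rw [b2, hQsa, ← mul_assoc, l2, neg_mul, neg_mul]
  · have h1P : (1 - P) * (1 - P) = 1 - P := hPp.one_sub.isIdempotentElem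
    have h1s : star (1 - P) = 1 - P := hPp.one_sub.isSelfAdjoint
    rw [mul_one_sub_mul, h1P, b2, sub_neg_eq_add, add_sub_cancel_left]
    nth_rewrite 1 [← h1s]
    exact star_left_conjugate_nonneg a0 _

end QuasiProjectionPairs
end HilbertCStar
end
theorem mainTheorem7 {A H : Type*} [NonUnitalCStarAlgebra A] [PartialOrder A] [StarOrderedRing A]
    [NormedAddCommGroup H] [NormedSpace ℂ H] [CompleteSpace H] [SMul A H] [CStarModule A H]
    (Q : HilbertCStar.Adjointable A H) (hQ : IsIdempotentElem Q) :
    (HilbertCStar.IsHarmonious (HilbertCStar.matchedProjection Q) Q ↔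
      HilbertCStar.IsSemiHarmonious (HilbertCStar.matchedProjection Q) Q) ∧
    HilbertCStar.IsSemiHarmonious (HilbertCStar.matchedProjection Q) (1 - Q) := by
  obtain ⟨P, hP⟩ : ∃ P, P = HilbertCStar.matchedProjection Q := ⟨_, rfl⟩
  rw [← hP]
  obtain ⟨h, hK, hK'⟩ := HilbertCStar.matchedProjection_spec hQ hP
  -- The pair `(1 - P, 1 - Q)` has the off-diagonal blocks of `(P, Q)` interchanged and negated, so
  -- results for it concern the same closed ranges.
  have h' := h.one_sub_left.one_sub_right
  have hPP : (1 - P) * P = 0 := h.isStarProjection.isIdempotentElem.one_sub_mul_self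
  have hPP' : P * (1 - P) = 0 := h.isStarProjection.isIdempotentElem.mul_one_sub_self
  have e1 : (1 - P) * (1 - Q) * (1 - (1 - P)) = -((1 - P) * Q * P) := by
    rw [sub_sub_cancel, mul_one_sub_mul, hPP, zero_sub]
  have e2 : (1 - (1 - P)) * (1 - Q) * (1 - P) = -(P * Q * (1 - P)) := by
    rw [sub_sub_cancel, mul_one_sub_mul, hPP', zero_sub]
  have e3 : (1 - P) * (1 - (1 - Q)) = (1 - P) * Q := by rw [sub_sub_cancel]
  refine ⟨⟨fun hh => ⟨h, ?_, ?_⟩, fun hs => ⟨h, ?_, ?_⟩⟩, h.one_sub_right, ?_, ?_⟩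
  · exact h.hasPolarDecomposition_mul_one_sub hK hh.complemented_left hh.complemented_right
  · rw [← e3]
    refine h'.hasPolarDecomposition_mul_one_sub hK' ?_ ?_
    · rw [e1, HilbertCStar.closedRange_neg]; exact hh.complemented_right
    · rw [e2, HilbertCStar.closedRange_neg]; exact hh.complemented_left
  -- Both closed ranges equal that of `K`, so complementedness transfers from `P (1 - Q)` to `P Q (1
  -- - P)`.
  · obtain ⟨h1, h2⟩ := h.closedRanges rfl rfl hK
    rw [h1, ← h2]
    exact hs.polar_left.isOrthogonallyComplemented
  · obtain ⟨h1, h2⟩ := h'.closedRanges rfl rfl hK'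
    rw [← HilbertCStar.closedRange_neg, ← e1, h1, ← h2, e3]
    exact hs.polar_right.isOrthogonallyComplemented
  · rw [sub_sub_cancel]
    exact h.hasPolarDecomposition_mul hK
  · exact h'.hasPolarDecomposition_mul hK'
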